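/- Let $\mathcal H$ and $\mathcal K$ be complex Hilbert spaces, let $F\colon\mathcal H\to\mathcal K$ be a closed densely defined linear operator with trivial kernel and dense range, let $J$ be a bounded self-adjoint operator on $\mathcal K$, let $V=F^*JF$ (with its natural domain), and let $H_0$ be an operator on $\mathcal H$ with $\operatorname{dom}H_0\subset\operatorname{dom}F\cap\operatorname{dom}V$. Assume that for every real $r$ the operator $H_r=H_0+rV$ is self-adjoint on $\operatorname{dom}H_0$, and that for every real $r$ and every non-real $z$ the operator $F(H_r-z)^{-1}F^*$, defined on $\operatorname{dom}F^*$, is bounded and its continuous extension $T_z(H_r)$ to $\mathcal K$ is compact. For real $s$ put $A_z(s)=T_z(H_s)J$ and $B_z(s)=JT_z(H_s)$. A number $r_z\in\mathbb C$ is a resonance point corresponding to $z$ if $(1+(r_z-s)A_z(s))u=0$ has a non-zero solution $u\in\mathcal K$ (this does not depend on the real number $s$); it is an up-point if moreover $\operatorname{Im}r_z>0$. For a finite set $\Gamma$ of non-real numbers and a real number $s$ put $$P_z(\Gamma)=\sum_{r\in\Gamma}\frac1{2\pi i}\oint_{C((s-r)^{-1})}(\sigma-A_z(s))^{-1}\,d\sigma,\qquad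 Q_z(\Gamma)=\sum_{r\in\Gamma}\frac1{2\pi i}\oint_{C((s-r)^{-1})}(\sigma-B_z(s))^{-1}\,d\sigma,$$ where $C(\sigma_0)$ denotes a sufficiently small positively oriented circle centred at $\sigma_0$, and let $\bar\Gamma=\{\bar r\colon r\in\Gamma\}$. Theorem. Let $z$ be a non-real number and let $\Gamma$ be a finite set of resonance up-points corresponding to $z$. Then, for every choice of the real number $s$, the operator $$\operatorname{Im}z\;Q_{\bar z}(\bar\Gamma)\,J\,P_z(\Gamma)$$ is non-negative (in particular self-adjoint), and its rank is equal to the rank of $P_z(\Gamma)$. -/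

import Mathlib

namespace Resonance

/-! ### Partial operators -/

section PartialOperators

variable {E₁ E₂ E₃ : Type*} [AddCommGroup E₁] [Module ℂ E₁] [AddCommGroup E₂] [Module ℂ E₂]
  [AddCommGroup E₃] [Module ℂ E₃]

/-- The product `g f` of two partially defined operators, with its natural domain
`{x ∈ dom f | f x ∈ dom g}`. -/
def pcomp (g : E₂ →ₗ.[ℂ] E₃) (f : E₁ →ₗ.[ℂ] E₂) : E₁ →ₗ.[ℂ] E₃ :=
  g.comp (f.domRestrict ((g.domain.comap f.toFun).map f.domain.subtype)) (by
    rintro ⟨x, hx, hxf⟩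
    obtain ⟨y, hy, rfl⟩ := hx
    exact hy)

theorem mem_pcomp_domain (g : E₂ →ₗ.[ℂ] E₃) (f : E₁ →ₗ.[ℂ] E₂) (x : E₁) :
    x ∈ (pcomp g f).domain ↔ ∃ h : x ∈ f.domain, f ⟨x, h⟩ ∈ g.domain := by
  constructor
  · rintro ⟨⟨y, hy, rfl⟩, -⟩
    exact ⟨y.2, hy⟩
  · rintro ⟨h, hg⟩
    exact ⟨⟨⟨x, h⟩, hg, rfl⟩, h⟩

theorem pcomp_apply (g : E₂ →ₗ.[ℂ] E₃) (f : E₁ →ₗ.[ℂ] E₂) (x : E₁) (h : x ∈ f.domain)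
    (hg : f ⟨x, h⟩ ∈ g.domain) (hx : x ∈ (pcomp g f).domain) :
    pcomp g f ⟨x, hx⟩ = g ⟨f ⟨x, h⟩, hg⟩ := rfl

/-- The operator `H - z`, with the domain of `H`. -/
def shift (H : E₁ →ₗ.[ℂ] E₁) (z : ℂ) : E₁ →ₗ.[ℂ] E₁ :=
  (-(z • (LinearMap.id : E₁ →ₗ[ℂ] E₁))) +ᵥ H

/-- The resolvent `R_z(H) = (H - z)⁻¹`, defined on the range of `H - z`. -/
noncomputable def res (H : E₁ →ₗ.[ℂ] E₁) (z : ℂ) : E₁ →ₗ.[ℂ] E₁ :=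
  (shift H z).inverse

end PartialOperators

section Bounded

variable {K : Type*} [NormedAddCommGroup K] [InnerProductSpace ℂ K]

/-- `S` is bounded on its domain and has a compact continuous prolonging to the whole space. -/
def HasCompactExtension (S : K →ₗ.[ℂ] K) : Prop :=
  ∃ T : K →L[ℂ] K, IsCompactOperator T ∧ ∀ x : S.domain, T x = S x

open Classical in
/-- The bounded operator on the whole space which prolongs a (densely defined) operator `S`;
it is unique when the domain of `S` is dense. (If there is none, the value is `0`.) -/
noncomputable def boundedExtension (S : K →ₗ.[ℂ] K) : K →L[ℂ] K :=
  if h : ∃ T : K →L[ℂ] K, ∀ x : S.domain, T x = S x then h.choose else 0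

/-- The Riesz idempotent `(2πi)⁻¹ ∮_{C(σ)} (ζ - A)⁻¹ dζ` of `A` at `σ`, where `C(σ)` is a small
counter-clockwise circle centred at `σ`. When `σ` is at most an isolated point of the spectrum
of `A`, the integral has the same value for all small radii, and the limit is this value. -/
noncomputable def rieszIdempotent (A : K →L[ℂ] K) (σ : ℂ) : K →L[ℂ] K :=
  Filter.limUnder (nhdsWithin (0 : ℝ) (Set.Ioi 0)) fun ε : ℝ =>
    (2 * (Real.pi : ℂ) * Complex.I)⁻¹ • ∮ ζ in C(σ, ε), resolvent A ζ

end Bounded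

/-! ### The line of operators `H_r = H₀ + r V`, `V = F* J F` -/

section Line

variable {𝓗 𝓚 : Type*} [NormedAddCommGroup 𝓗] [InnerProductSpace ℂ 𝓗] [CompleteSpace 𝓗]
  [NormedAddCommGroup 𝓚] [InnerProductSpace ℂ 𝓚] [CompleteSpace 𝓚]

/-- A rigging operator: a closed densely defined operator with trivial kernel and co-kernel. -/
structure IsRigging (F : 𝓗 →ₗ.[ℂ] 𝓚) : Prop where
  dense_domain : Dense (F.domain : Set 𝓗)
  isClosed : F.IsClosed
  ker_eq_bot : LinearMap.ker F.toFun = ⊥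
  dense_range : Dense (LinearMap.range F.toFun : Set 𝓚)

/-- The perturbation `V = F* J F`, with its natural domain. -/
noncomputable def perturbation (F : 𝓗 →ₗ.[ℂ] 𝓚) (J : 𝓚 →L[ℂ] 𝓚) : 𝓗 →ₗ.[ℂ] 𝓗 :=
  pcomp F.adjoint ((J : 𝓚 →ₗ[ℂ] 𝓚).compPMap F)

/-- The operator `H_r = H₀ + r V` for real `r`. -/
noncomputable def line (H₀ : 𝓗 →ₗ.[ℂ] 𝓗) (F : 𝓗 →ₗ.[ℂ] 𝓚) (J : 𝓚 →L[ℂ] 𝓚) (r : ℝ) :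
    𝓗 →ₗ.[ℂ] 𝓗 :=
  H₀ + (r : ℂ) • perturbation F J

/-- The product `F R_z(H) F*` as a partially defined operator. -/
noncomputable def sandwichedRes (F : 𝓗 →ₗ.[ℂ] 𝓚) (H : 𝓗 →ₗ.[ℂ] 𝓗) (z : ℂ) : 𝓚 →ₗ.[ℂ] 𝓚 :=
  pcomp F (pcomp (res H z) F.adjoint)

/-- The standing assumptions on `H₀`, `F` and `J`: `F` is a rigging operator, `J` is bounded and
self-adjoint, all the operators `H_r = H₀ + r F* J F` (`r` real) are self-adjoint with the common
domain `dom H₀`, which is contained in `dom F`, and for all real `r` and non-real `z` the operator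
`F R_z(H_r) F*` is bounded with compact prolonging. -/
structure StandingAssumptions (H₀ : 𝓗 →ₗ.[ℂ] 𝓗) (F : 𝓗 →ₗ.[ℂ] 𝓚) (J : 𝓚 →L[ℂ] 𝓚) : Prop where
  isRigging : IsRigging F
  selfAdjoint_J : IsSelfAdjoint J
  domain_le_F : H₀.domain ≤ F.domain
  domain_le_V : H₀.domain ≤ (perturbation F J).domain
  selfAdjoint_line : ∀ r : ℝ, IsSelfAdjoint (line H₀ F J r)
  compact : ∀ (r : ℝ) (z : ℂ), z.im ≠ 0 → HasCompactExtension (sandwichedRes F (line H₀ F J r) z)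

/-- The bounded operator `T_z(H_s) = F R_z(H_s) F*` on the auxiliary space. -/
noncomputable def T (H₀ : 𝓗 →ₗ.[ℂ] 𝓗) (F : 𝓗 →ₗ.[ℂ] 𝓚) (J : 𝓚 →L[ℂ] 𝓚) (z : ℂ) (s : ℝ) :
    𝓚 →L[ℂ] 𝓚 :=
  boundedExtension (sandwichedRes F (line H₀ F J s) z)

/-- `A_z(s) = T_z(H_s) J`. -/
noncomputable def A (H₀ : 𝓗 →ₗ.[ℂ] 𝓗) (F : 𝓗 →ₗ.[ℂ] 𝓚) (J : 𝓚 →L[ℂ] 𝓚) (z : ℂ) (s : ℝ) :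
    𝓚 →L[ℂ] 𝓚 :=
  T H₀ F J z s ∘L J

/-- `B_z(s) = J T_z(H_s)`. -/
noncomputable def B (H₀ : 𝓗 →ₗ.[ℂ] 𝓗) (F : 𝓗 →ₗ.[ℂ] 𝓚) (J : 𝓚 →L[ℂ] 𝓚) (z : ℂ) (s : ℝ) :
    𝓚 →L[ℂ] 𝓚 :=
  J ∘L T H₀ F J z s

/-- `r` is a resonance point corresponding to the non-real number `z`: the resonance equation
`(1 + (r - s) A_z(s)) u = 0` has a non-zero solution for some real `s`
(equivalently, for every real `s`). -/
def IsResonancePoint (H₀ : 𝓗 →ₗ.[ℂ] 𝓗) (F : 𝓗 →ₗ.[ℂ] 𝓚) (J : 𝓚 →L[ℂ] 𝓚) (z r : ℂ) : Prop :=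
  ∃ s : ℝ, ∃ u : 𝓚, u ≠ 0 ∧ u + (r - s) • A H₀ F J z s u = 0

/-- A resonance up-point is a resonance point in the open upper half-plane. -/
def IsUpPoint (H₀ : 𝓗 →ₗ.[ℂ] 𝓗) (F : 𝓗 →ₗ.[ℂ] 𝓚) (J : 𝓚 →L[ℂ] 𝓚) (z r : ℂ) : Prop :=
  IsResonancePoint H₀ F J z r ∧ 0 < r.im

/-- `P_z(Γ) = ∑_{r ∈ Γ} P_z(r)`, where `P_z(r)` is the Riesz idempotent of `A_z(s)` at the
eigenvalue `(s - r)⁻¹`. -/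
noncomputable def P (H₀ : 𝓗 →ₗ.[ℂ] 𝓗) (F : 𝓗 →ₗ.[ℂ] 𝓚) (J : 𝓚 →L[ℂ] 𝓚) (s : ℝ) (z : ℂ)
    (Γ : Finset ℂ) : 𝓚 →L[ℂ] 𝓚 :=
  ∑ r ∈ Γ, rieszIdempotent (A H₀ F J z s) ((s : ℂ) - r)⁻¹

/-- `Q_z(Γ) = ∑_{r ∈ Γ} Q_z(r)`, where `Q_z(r)` is the Riesz idempotent of `B_z(s)` at the
eigenvalue `(s - r)⁻¹`. -/
noncomputable def Q (H₀ : 𝓗 →ₗ.[ℂ] 𝓗) (F : 𝓗 →ₗ.[ℂ] 𝓚) (J : 𝓚 →L[ℂ] 𝓚) (s : ℝ) (z : ℂ)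
    (Γ : Finset ℂ) : 𝓚 →L[ℂ] 𝓚 :=
  ∑ r ∈ Γ, rieszIdempotent (B H₀ F J z s) ((s : ℂ) - r)⁻¹

end Line

end Resonance

/-! Write P = P_z(Γ), A = A_z(s) = TJ and y = Im z. Since T_z(H_s)* = T_{z̄}(H_s) and J is
self-adjoint, B_{z̄}(s) is the adjoint of A. Hence Q_{z̄}(Γ̄) = P*, and the operator in question is
M = y P*JP. It is enough that the form y⟨v, Jv⟩ is positive definite on the range of P: then M ≥ 0
and ker M = ker P, so the ranks agree.

Positive definiteness is a Lyapunov argument (`HasDecayingOrbit.form_pos`). A vector v in the range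
of P is a sum of generalised eigenvectors of A with eigenvalues (s - r)⁻¹. The inverse of A on them
has eigenvalues s - r in the open lower half-plane, so the solution of A u' = -i u with u(0) = v
decays at +∞. With w = i u' one has u = TJw, and y⟨u, Ju⟩ has derivative -2y Im⟨Jw, TJw⟩ ≤ 0. Being
non-increasing with limit 0, it is non-negative at t = 0. If it vanishes there, it vanishes for all
t ≥ 0, so Im⟨Jw(0), TJw(0)⟩ = 0; as Im⟨φ, Tφ⟩ = 0 forces Tφ = 0 (`T_apply_eq_zero`), v = TJw(0) = 0.

The contour integrals enter only through `exists_splitting`: compactness splits A - σ into a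
nilpotent and an invertible part, and the Riesz idempotent is the projection onto the former. The
adjoint of a splitting is a splitting of A*, which gives Q = P*. -/

namespace Resonance

open Filter Topology

/-! ### Laurent expansion of the resolvent and its residue -/

section BanachAlgebra

variable {𝔸 : Type*} [NormedRing 𝔸] [NormedAlgebra ℂ 𝔸]

/-- The Laurent expansion of the resolvent of `a` at `σ`, given a splitting `D S = S D = 1 - E` of
`D = a - σ` into a nilpotent part on `E` and an invertible part on `1 - E`. -/
theorem resolvent_eq_of_splitting {a S E : 𝔸} {σ : ℂ} {n : ℕ}
    (hDS : (a - algebraMap ℂ 𝔸 σ) * S = 1 - E) (hSD : S * (a - algebraMap ℂ 𝔸 σ) = 1 - E)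
    (hES : E * S = 0) (hn : (a - algebraMap ℂ 𝔸 σ) ^ n * E = 0)
    {ζ : ℂ} (hζ : ζ ≠ σ) (hu : IsUnit (1 - (ζ - σ) • S)) :
    resolvent a ζ = ∑ k ∈ Finset.range n, ((ζ - σ) ^ (k + 1))⁻¹ •
        ((a - algebraMap ℂ 𝔸 σ) ^ k * E) - S * Ring.inverse (1 - (ζ - σ) • S) := by
  set D := a - algebraMap ℂ 𝔸 σ with hD
  set w := ζ - σ with hw
  have hw0 : w ≠ 0 := sub_ne_zero.mpr hζ
  have hX : algebraMap ℂ 𝔸 ζ - a = algebraMap ℂ 𝔸 w - D := by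
    rw [hD, hw, map_sub]; abel
  have hE : E = 1 - D * S := by rw [hDS]; abel
  have cDS : Commute D S := by rw [Commute, SemiconjBy, hDS, hSD]
  have cDE : Commute D E := by
    rw [hE]; exact (Commute.one_right D).sub_right ((Commute.refl D).mul_right cDS)
  have cwS : Commute D (1 - w • S) := (Commute.one_right D).sub_right (cDS.smul_right w)
  set V := Ring.inverse (1 - w • S) with hV
  have hV1 : (1 - w • S) * V = 1 := Ring.mul_inverse_cancel _ hu
  have cDV : Commute D V := by
    obtain ⟨u, hu'⟩ := hu
    rw [hV, ← hu', Ring.inverse_unit]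
    exact Commute.units_inv_right (hu' ▸ cwS)
  have hEV : E * V = E := by
    calc E * V = (E * (1 - w • S)) * V := by simp [mul_sub, hES]
      _ = E := by rw [mul_assoc, hV1, mul_one]
  set Y := ∑ k ∈ Finset.range n, (w ^ (k + 1))⁻¹ • (D ^ k * E) - S * V with hY
  have cXY : Commute (algebraMap ℂ 𝔸 w - D) Y := by
    refine Commute.sub_left (Algebra.commutes w Y) (Commute.sub_right ?_ (cDS.mul_right cDV))
    refine Commute.sum_right _ _ _ fun k _ => Commute.smul_right ?_ _
    exact ((Commute.refl D).pow_right k).mul_right cDE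
  -- The sum telescopes, and its last term dies because D ^ n * E = 0.
  have hsum : (algebraMap ℂ 𝔸 w - D) * ∑ k ∈ Finset.range n, (w ^ (k + 1))⁻¹ • (D ^ k * E) = E := by
    have : ∀ k, (algebraMap ℂ 𝔸 w - D) * ((w ^ (k + 1))⁻¹ • (D ^ k * E)) =
        (w ^ k)⁻¹ • (D ^ k * E) - (w ^ (k + 1))⁻¹ • (D ^ (k + 1) * E) := by
      intro k
      rw [sub_mul, ← Algebra.smul_def, smul_smul, mul_smul_comm, ← mul_assoc, ← pow_succ']
      congr 2
      rw [pow_succ']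
      field_simp
    rw [Finset.mul_sum, Finset.sum_congr rfl fun k _ => this k, Finset.sum_range_sub']
    simp [hn]
  have hSV : (algebraMap ℂ 𝔸 w - D) * (S * V) = E - 1 := by
    have h : (algebraMap ℂ 𝔸 w - D) * S = E - (1 - w • S) := by
      rw [sub_mul, hDS, ← Algebra.smul_def]; abel
    rw [← mul_assoc, h, sub_mul, hV1, hEV]
  have hXY : (algebraMap ℂ 𝔸 w - D) * Y = 1 := by
    rw [hY, mul_sub, hsum, hSV]; abel
  have hu : algebraMap ℂ 𝔸 ζ - a = ((⟨algebraMap ℂ 𝔸 w - D, Y, hXY, cXY.eq ▸ hXY⟩ : 𝔸ˣ) : 𝔸) := hX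
  rw [resolvent, hu, Ring.inverse_unit]
  rfl

/-- In the Laurent expansion only the k = 0 term has a non-zero integral, and the remainder is
holomorphic wherever |ζ - σ| ‖S‖ < 1. -/
theorem circleIntegral_resolvent_of_splitting [CompleteSpace 𝔸] {a S E : 𝔸} {σ : ℂ} {n : ℕ}
    (hDS : (a - algebraMap ℂ 𝔸 σ) * S = 1 - E) (hSD : S * (a - algebraMap ℂ 𝔸 σ) = 1 - E)
    (hES : E * S = 0) (hn : (a - algebraMap ℂ 𝔸 σ) ^ n * E = 0) :
    ∀ᶠ ε : ℝ in 𝓝[>] 0,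
      (2 * (Real.pi : ℂ) * Complex.I)⁻¹ • (∮ ζ in C(σ, ε), resolvent a ζ) = E := by
  -- With n + 1 terms the k = 0 term is present even when n = 0.
  have hn' : (a - algebraMap ℂ 𝔸 σ) ^ (n + 1) * E = 0 := by rw [pow_succ', mul_assoc, hn, mul_zero]
  have hsmall : ∀ᶠ ε : ℝ in 𝓝[>] 0, ε * ‖S‖ < 1 := by
    have : Tendsto (fun ε : ℝ => ε * ‖S‖) (𝓝[>] 0) (𝓝 (0 * ‖S‖)) :=
      ((continuous_id.mul continuous_const).tendsto 0).mono_left nhdsWithin_le_nhds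
    rw [zero_mul] at this
    exact this.eventually_lt_const one_pos
  filter_upwards [hsmall, self_mem_nhdsWithin] with ε hε hε0
  have hε0 : 0 < ε := hε0
  have hunit : ∀ ζ ∈ Metric.closedBall σ ε, IsUnit (1 - (ζ - σ) • S) := by
    intro ζ hζ
    apply isUnit_one_sub_of_norm_lt_one
    rw [norm_smul]
    rw [Metric.mem_closedBall, dist_eq_norm] at hζ
    exact (mul_le_mul_of_nonneg_right hζ (norm_nonneg _)).trans_lt hε
  have hdiff : ∀ ζ ∈ Metric.closedBall σ ε, DifferentiableAt ℂ
      (fun ζ => S * Ring.inverse (1 - (ζ - σ) • S)) ζ := by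
    intro ζ hζ
    refine (differentiableAt_const S).mul ?_
    have h : DifferentiableAt ℂ (fun ζ => 1 - (ζ - σ) • S) ζ := by fun_prop
    exact DifferentiableAt.comp (g := Ring.inverse) ζ (differentiableAt_inverse (hunit ζ hζ)) h
  have hana : (∮ ζ in C(σ, ε), S * Ring.inverse (1 - (ζ - σ) • S)) = 0 := by
    apply Complex.circleIntegral_eq_zero_of_differentiable_on_off_countable hε0.le
      Set.countable_empty
    · exact fun ζ hζ => (hdiff ζ hζ).continuousAt.continuousWithinAt
    · exact fun ζ hζ => hdiff ζ (Metric.ball_subset_closedBall hζ.1)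
  have hint : ∀ k ∈ Finset.range (n + 1), CircleIntegrable (fun ζ => ((ζ - σ) ^ (k + 1))⁻¹ •
        ((a - algebraMap ℂ 𝔸 σ) ^ k * E)) σ ε := by
    intro k _
    apply ContinuousOn.circleIntegrable hε0.le
    refine ContinuousOn.smul (ContinuousOn.inv₀ (by fun_prop) ?_) continuousOn_const
    intro ζ hζ
    apply pow_ne_zero
    rw [sub_ne_zero]
    rintro rfl
    simp at hζ
    exact hε0.ne hζ
  have hterm : ∀ k ∈ Finset.range (n + 1), (∮ ζ in C(σ, ε), ((ζ - σ) ^ (k + 1))⁻¹ •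
        ((a - algebraMap ℂ 𝔸 σ) ^ k * E)) = if k = 0 then (2 * (Real.pi : ℂ) * Complex.I) • E else 0 := by
    intro k _
    rw [circleIntegral.integral_smul_const]
    split_ifs with hk
    · subst hk
      simp [circleIntegral.integral_sub_center_inv σ hε0.ne']
    · have := circleIntegral.integral_sub_zpow_of_ne (n := -((k : ℤ) + 1)) (by omega) σ σ ε
      have h2 : ∀ ζ : ℂ, ((ζ - σ) ^ (k + 1))⁻¹ = (ζ - σ) ^ (-((k : ℤ) + 1)) := by
        intro ζ; rw [zpow_neg]; norm_cast
      simp_rw [h2, this, zero_smul]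
  rw [circleIntegral.integral_congr hε0.le (g := fun ζ => ∑ k ∈ Finset.range (n + 1),
      ((ζ - σ) ^ (k + 1))⁻¹ • ((a - algebraMap ℂ 𝔸 σ) ^ k * E)
        - S * Ring.inverse (1 - (ζ - σ) • S)),
    circleIntegral.integral_sub, hana, circleIntegral.integral_fun_sum hint,
    Finset.sum_congr rfl hterm, sub_zero, Finset.sum_ite_eq']
  · simp only [Finset.mem_range, Nat.zero_lt_succ, if_true]
    rw [smul_smul, inv_mul_cancel₀ Complex.two_pi_I_ne_zero, one_smul]
  · exact CircleIntegrable.fun_sum _ hint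
  · apply ContinuousOn.circleIntegrable hε0.le
    exact fun ζ hζ =>
      (hdiff ζ (Metric.sphere_subset_closedBall hζ)).continuousAt.continuousWithinAt
  · intro ζ hζ
    refine resolvent_eq_of_splitting hDS hSD hES hn' ?_
      (hunit ζ (Metric.sphere_subset_closedBall hζ))
    rintro rfl
    simp at hζ
    exact hε0.ne hζ

end BanachAlgebra

/-! ### Riesz theory of compact operators: finite ascent and splitting -/

section Riesz

variable {K : Type*} [NormedAddCommGroup K] [InnerProductSpace ℂ K] [CompleteSpace K]

theorem rieszIdempotent_eq_of_splitting {A S E : K →L[ℂ] K} {σ : ℂ} {n : ℕ}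
    (hDS : (A - algebraMap ℂ _ σ) * S = 1 - E) (hSD : S * (A - algebraMap ℂ _ σ) = 1 - E)
    (hES : E * S = 0) (hn : (A - algebraMap ℂ _ σ) ^ n * E = 0) :
    rieszIdempotent A σ = E :=
  (tendsto_const_nhds.congr' ((circleIntegral_resolvent_of_splitting hDS hSD hES hn).mono
    fun _ h => h.symm)).limUnder_eq

theorem adjoint_sub_algebraMap (A : K →L[ℂ] K) (σ : ℂ) :
    ContinuousLinearMap.adjoint (A - algebraMap ℂ _ σ) =
      ContinuousLinearMap.adjoint A - algebraMap ℂ _ (starRingEnd ℂ σ) := by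
  ext x
  refine ext_inner_right ℂ fun y => ?_
  simp [ContinuousLinearMap.adjoint_inner_left, Algebra.algebraMap_eq_smul_one, inner_sub_left,
    inner_smul_left, inner_smul_right]

theorem isUnit_sub_algebraMap_of_adjoint {A : K →L[ℂ] K} {σ : ℂ}
    (h : IsUnit (algebraMap ℂ _ (starRingEnd ℂ σ) - ContinuousLinearMap.adjoint A)) :
    IsUnit (A - algebraMap ℂ _ σ) := by
  have h := h.neg.star
  rwa [neg_sub, ← adjoint_sub_algebraMap, ← ContinuousLinearMap.star_eq_adjoint, star_star] at h

/-- A compact operator has finite ascent at every non-zero point. -/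
theorem exists_ker_pow_succ_le {A : K →L[ℂ] K} (hA : IsCompactOperator A) {σ : ℂ} (hσ : σ ≠ 0) :
    ∃ n : ℕ, ∀ x, ((A - algebraMap ℂ _ σ) ^ (n + 1)) x = 0 → ((A - algebraMap ℂ _ σ) ^ n) x = 0 := by
  by_contra! h
  set D := A - algebraMap ℂ (K →L[ℂ] K) σ with hD
  have hex : ∀ n : ℕ, ∃ x, (D ^ (n + 1)) x = 0 ∧ ‖x‖ = 1 ∧
      ∀ y, (D ^ n) y = 0 → 1 ≤ ‖x + y‖ := by
    intro n
    obtain ⟨x, hx, hx'⟩ := h n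
    -- The Riesz lemma with constant 1: the normalised component of x orthogonal to ker D ^ n.
    let N : Submodule ℂ K := LinearMap.ker (D ^ n : K →L[ℂ] K).toLinearMap
    have hN : IsClosed (N : Set K) := (D ^ n).isClosed_ker
    have : CompleteSpace N := hN.completeSpace_coe
    have hp : (D ^ n) (N.starProjection x) = 0 :=
      LinearMap.mem_ker.mp (N.starProjection_apply_mem x)
    set y := x - N.starProjection x with hy
    have hyN : y ∈ Nᗮ := N.sub_starProjection_mem_orthogonal x
    have hy0 : y ≠ 0 := by
      intro h0
      apply hx'
      have : x = N.starProjection x := sub_eq_zero.mp h0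
      rw [this, hp]
    have hyn : ‖y‖ ≠ 0 := norm_ne_zero_iff.mpr hy0
    have hu : ‖((‖y‖⁻¹ : ℝ) : ℂ) • y‖ = 1 := by
      rw [norm_smul, Complex.norm_real, norm_inv, norm_norm, inv_mul_cancel₀ hyn]
    refine ⟨((‖y‖⁻¹ : ℝ) : ℂ) • y, ?_, hu, fun v hv => ?_⟩
    · rw [map_smul, hy, map_sub, hx, pow_succ', mul_apply_eq_comp, hp]; simp
    · have hort : inner ℂ (((‖y‖⁻¹ : ℝ) : ℂ) • y) v = 0 := by
        rw [inner_smul_left, N.inner_left_of_mem_orthogonal (LinearMap.mem_ker.mpr hv) hyN, mul_zero]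
      have := norm_add_sq_eq_norm_sq_add_norm_sq_of_inner_eq_zero _ _ hort
      rw [hu] at this
      nlinarith [norm_nonneg (((‖y‖⁻¹ : ℝ) : ℂ) • y + v), mul_self_nonneg ‖v‖]
  choose x hx hx1 hxd using hex
  have hker : ∀ {m n : ℕ} (_ : m ≤ n) {y : K}, (D ^ m) y = 0 → (D ^ n) y = 0 := by
    intro m n hmn y hy
    obtain ⟨k, rfl⟩ := Nat.exists_eq_add_of_le' hmn
    rw [pow_add, mul_apply_eq_comp, hy, map_zero]
  -- The difference is σ (x n + y) with y in ker D ^ n, so the images of the unit vectors x n have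
  -- no Cauchy subsequence, against compactness.
  have hfar : ∀ m n, m < n → ‖σ‖ ≤ ‖A (x n) - A (x m)‖ := by
    intro m n hmn
    have hAx : ∀ k, A (x k) = D (x k) + σ • x k := by
      intro k; simp [hD, Algebra.algebraMap_eq_smul_one]
    set y := σ⁻¹ • (D (x n) - D (x m) - σ • x m) with hy
    have heq : A (x n) - A (x m) = σ • (x n + y) := by
      rw [hAx, hAx, hy, smul_add, smul_inv_smul₀ hσ]; abel
    have h1 : (D ^ n) (D (x n)) = 0 := by
      rw [← mul_apply_eq_comp, ← pow_succ, hx]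
    have h2 : (D ^ n) (D (x m)) = 0 := by
      rw [← mul_apply_eq_comp, ← pow_succ]
      exact hker (by omega) (hx m)
    have h3 : (D ^ n) (x m) = 0 := hker (by omega) (hx m)
    have hyn : (D ^ n) y = 0 := by
      rw [hy, map_smul, map_sub, map_sub, map_smul, h1, h2, h3]; simp
    rw [heq, norm_smul]
    exact le_mul_of_one_le_right (norm_nonneg _) (hxd n y hyn)
  obtain ⟨C, hC, hC'⟩ := hA.image_closedBall_subset_compact 1
  obtain ⟨y, -, ψ, hψ, hψy⟩ := hC.tendsto_subseq
    (x := fun n => A (x n)) (fun n => hC' ⟨x n, by simp [hx1], rfl⟩)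
  have hc := hψy.cauchySeq
  rw [Metric.cauchySeq_iff'] at hc
  obtain ⟨N, hN⟩ := hc ‖σ‖ (norm_pos_iff.mpr hσ)
  have := hN (N + 1) (by omega)
  rw [dist_eq_norm] at this
  exact absurd this (not_lt.mpr (hfar _ _ (hψ (Nat.lt_succ_self N))))

/-- If the adjoint of `A` is compact then `A` splits at every non-zero point `σ` into a nilpotent
part and a part at which `A - σ` is invertible. -/
theorem exists_splitting {A : K →L[ℂ] K} (hA : IsCompactOperator (ContinuousLinearMap.adjoint A))
    {σ : ℂ} (hσ : σ ≠ 0) :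
    ∃ (n : ℕ) (S E : K →L[ℂ] K), (A - algebraMap ℂ _ σ) * S = 1 - E ∧
      S * (A - algebraMap ℂ _ σ) = 1 - E ∧ E * S = 0 ∧ S * E = 0 ∧
      (A - algebraMap ℂ _ σ) ^ n * E = 0 := by
  set D := A - algebraMap ℂ (K →L[ℂ] K) σ with hD
  set D' := ContinuousLinearMap.adjoint A - algebraMap ℂ (K →L[ℂ] K) (starRingEnd ℂ σ) with hD'
  have hDD' : star D = D' := by
    rw [hD, hD', ContinuousLinearMap.star_eq_adjoint, adjoint_sub_algebraMap]
  have hadj : ∀ x y, inner ℂ (D' x) y = inner ℂ x (D y) := by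
    intro x y
    rw [← hDD', ContinuousLinearMap.star_eq_adjoint, ContinuousLinearMap.adjoint_inner_left]
  obtain ⟨n, hn⟩ := exists_ker_pow_succ_le hA ((map_ne_zero (starRingEnd ℂ)).mpr hσ)
  rw [← hD'] at hn
  have hadjn : ∀ x y, inner ℂ ((D' ^ n) x) y = inner ℂ x ((D ^ n) y) := by
    intro x y
    rw [← hDD', ← star_pow, ContinuousLinearMap.star_eq_adjoint,
      ContinuousLinearMap.adjoint_inner_left]
  let N : Submodule ℂ K := LinearMap.ker (D' ^ n : K →L[ℂ] K).toLinearMap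
  have hN : IsClosed (N : Set K) := (D' ^ n).isClosed_ker
  have : CompleteSpace N := hN.completeSpace_coe
  have hmemN : ∀ x, x ∈ N ↔ (D' ^ n) x = 0 := fun x => LinearMap.mem_ker
  -- R is the closure of the range of D ^ n. It is D-invariant because N is D'-invariant.
  let R : Submodule ℂ K := Nᗮ
  have hmemR : ∀ x, x ∈ R ↔ ∀ y, (D' ^ n) y = 0 → inner ℂ y x = 0 := fun x =>
    N.mem_orthogonal x
  have hDR : ∀ x ∈ R, D x ∈ R := by
    intro x hx
    rw [hmemR] at hx ⊢
    intro y hy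
    rw [← hadj]
    apply hx
    rw [← mul_apply_eq_comp, ← pow_succ, pow_succ', mul_apply_eq_comp, hy, map_zero]
  have hDn : ∀ x, (D ^ n) x ∈ R := by
    intro x
    rw [hmemR]
    intro y hy
    rw [← hadjn, hy, inner_zero_left]
  have hAx : ∀ x, A x = D x + σ • x := by
    intro x; simp [hD, Algebra.algebraMap_eq_smul_one]
  have hAR : ∀ x ∈ R, A x ∈ R := fun x hx => by
    rw [hAx]; exact R.add_mem (hDR x hx) (R.smul_mem _ hx)
  set p : K →L[ℂ] R := R.orthogonalProjectionOnto with hp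
  have hpx : ∀ x ∈ R, (p x : K) = x := fun x hx => R.starProjection_eq_self_iff.mpr hx
  set AR : R →L[ℂ] R := p ∘L A ∘L R.subtypeL with hARdef
  have hARx : ∀ x : R, (AR x : K) = A x := fun x => hpx _ (hAR x x.2)
  have hcomp : IsCompactOperator (ContinuousLinearMap.adjoint AR) := by
    have : ContinuousLinearMap.adjoint AR = p ∘L ContinuousLinearMap.adjoint A ∘L R.subtypeL := by
      rw [hARdef, ContinuousLinearMap.adjoint_comp, ContinuousLinearMap.adjoint_comp, hp,
        Submodule.adjoint_subtypeL, Submodule.adjoint_orthogonalProjectionOnto]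
      rfl
    rw [this]
    exact (hA.comp_clm R.subtypeL).clm_comp p
  set DR : R →L[ℂ] R := AR - algebraMap ℂ _ σ with hDRdef
  have hDRx : ∀ x : R, (DR x : K) = D x := by
    intro x
    simp [hDRdef, hD, hARx, Algebra.algebraMap_eq_smul_one]
  -- By the Fredholm alternative for the compact adjoint of `AR`, only the eigenvalue σ̄ has to be
  -- excluded. An eigenvector y in R has D' y in Rᗮ = N, hence lies in N by finite ascent, and N ∩ R
  -- = 0.
  have hunit : IsUnit DR := by
    have hres := (IsCompactOperator.hasEigenvalue_or_mem_resolventSet hcomp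
      ((map_ne_zero (starRingEnd ℂ)).mpr hσ)).resolve_left ?_
    · rw [spectrum.mem_resolventSet_iff] at hres
      exact isUnit_sub_algebraMap_of_adjoint hres
    · intro hev
      obtain ⟨y, hy⟩ := hev.exists_hasEigenvector
      have hy1 := hy.apply_eq_smul
      have hy0 := hy.2
      apply hy0
      have hyN : D' y ∈ Rᗮ := by
        rw [Submodule.mem_orthogonal]
        intro x hx
        rw [← inner_conj_symm, hadj, map_eq_zero]
        have h1 : inner ℂ (y : K) (A x) = inner ℂ (ContinuousLinearMap.adjoint AR y) ⟨x, hx⟩ := by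
          rw [ContinuousLinearMap.adjoint_inner_left, Submodule.coe_inner, hARx]
        have h2 : ContinuousLinearMap.adjoint AR y = starRingEnd ℂ σ • y := hy1
        have h3 : D x = A x - σ • x := by rw [hAx]; abel
        rw [h3, inner_sub_right, h1, h2, inner_smul_left, inner_smul_right, Submodule.coe_inner]
        simp
      have hNN : Rᗮ = N := N.orthogonal_orthogonal
      rw [hNN, hmemN, ← mul_apply_eq_comp, ← pow_succ] at hyN
      have := (hmemR y).mp y.2 y (hn _ hyN)
      exact Subtype.ext (inner_self_eq_zero.mp this)
  obtain ⟨u, hu⟩ := hunit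
  set W : R →L[ℂ] R := ((u⁻¹ : (R →L[ℂ] R)ˣ) : R →L[ℂ] R) with hW
  have hDW : DR * W = 1 := by rw [← hu, hW, Units.mul_inv]
  have hWD : W * DR = 1 := by rw [← hu, hW, Units.inv_mul]
  have hDWn : DR ^ n * W ^ n = 1 := by
    rw [← hu, hW, ← Units.val_pow_eq_pow_val, ← Units.val_pow_eq_pow_val, inv_pow, Units.mul_inv]
  have hWDn : W ^ n * DR ^ n = 1 := by
    rw [← hu, hW, ← Units.val_pow_eq_pow_val, ← Units.val_pow_eq_pow_val, inv_pow, Units.inv_mul]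
  have hDRn : ∀ (k : ℕ) (x : R), ((DR ^ k) x : K) = (D ^ k) x := by
    intro k
    induction k with
    | zero => simp
    | succ k ih => intro x; rw [pow_succ, pow_succ, mul_apply_eq_comp, mul_apply_eq_comp, ih, hDRx]
  -- As D ^ n maps into R, where D is invertible with inverse W, q is the projection onto R along
  -- ker D ^ n, and it commutes with D.
  set q : K →L[ℂ] R := (W ^ n) ∘L p ∘L (D ^ n) with hq
  have hqx : ∀ x, q x = (W ^ n) (p ((D ^ n) x)) := fun x => rfl
  have hqR : ∀ x : R, q x = x := by
    intro x
    have h : p ((D ^ n) x) = (DR ^ n) x := Subtype.ext (by rw [hpx _ (hDn x), hDRn])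
    rw [hqx, h, ← mul_apply_eq_comp, hWDn]; rfl
  have hqD : ∀ x, q (D x) = DR (q x) := by
    intro x
    have h : p ((D ^ n) (D x)) = DR (p ((D ^ n) x)) := Subtype.ext (by
      rw [hpx _ (hDn _), hDRx, hpx _ (hDn _), ← mul_apply_eq_comp, ← mul_apply_eq_comp,
        ← pow_succ, ← pow_succ'])
    have hc : W ^ n * DR = DR * W ^ n :=
      (show Commute W DR by rw [Commute, SemiconjBy, hDW, hWD]).pow_left n
    rw [hqx, h, hqx, ← mul_apply_eq_comp, hc, mul_apply_eq_comp]
  have hDq : ∀ x, (D ^ n) (q x : K) = (D ^ n) x := by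
    intro x
    rw [← hDRn, hqx, ← mul_apply_eq_comp, hDWn]
    exact hpx _ (hDn x)
  have hWDx : ∀ x, W (DR x) = x := fun x => by rw [← mul_apply_eq_comp, hWD]; rfl
  have hDWx : ∀ x, DR (W x) = x := fun x => by rw [← mul_apply_eq_comp, hDW]; rfl
  refine ⟨n, R.subtypeL ∘L W ∘L q, 1 - R.subtypeL ∘L q, ?_, ?_, ?_, ?_, ?_⟩
  · ext x
    have : D (W (q x) : K) = q x := by rw [← hDRx, hDWx]
    simpa using this
  · ext x
    have : W (q (D x)) = q x := by rw [hqD, hWDx]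
    simpa using congrArg Subtype.val this
  · ext x
    simp [hqR]
  · ext x
    simp [hqR]
  · ext x
    rw [mul_apply_eq_comp, sub_apply, map_sub]
    exact sub_eq_zero.mpr (hDq x).symm

end Riesz

/-! ### Decaying orbits and the Lyapunov argument -/

section Orbits

variable {K : Type*} [NormedAddCommGroup K] [InnerProductSpace ℂ K]

/-- The evolution equation `A u' = -i u`, `u 0 = v`, has a solution which decays at `+∞`;
here `w = i u'`. -/
def HasDecayingOrbit (A : K →L[ℂ] K) (v : K) : Prop :=
  ∃ u w : ℝ → K, u 0 = v ∧ (∀ t, HasDerivAt u (-Complex.I • w t) t) ∧ (∀ t, A (w t) = u t) ∧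
    Tendsto u atTop (𝓝 0)

theorem HasDecayingOrbit.zero (A : K →L[ℂ] K) : HasDecayingOrbit A 0 :=
  ⟨fun _ => 0, fun _ => 0, rfl, fun t => by simpa using hasDerivAt_const t (0 : K), by simp,
    tendsto_const_nhds⟩

theorem HasDecayingOrbit.add {A : K →L[ℂ] K} {v v' : K} (h : HasDecayingOrbit A v)
    (h' : HasDecayingOrbit A v') : HasDecayingOrbit A (v + v') := by
  obtain ⟨u, w, h0, hd, hA, hl⟩ := h
  obtain ⟨u', w', h0', hd', hA', hl'⟩ := h'
  refine ⟨u + u', w + w', by simp [h0, h0'], fun t => ?_, fun t => by simp [hA, hA'], ?_⟩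
  · simpa only [Pi.add_apply, smul_add] using (hd t).add (hd' t)
  · rw [← add_zero (0 : K)]
    exact hl.add hl'

theorem HasDecayingOrbit.sum {A : K →L[ℂ] K} {ι : Type*} (s : Finset ι) {v : ι → K}
    (h : ∀ i ∈ s, HasDecayingOrbit A (v i)) : HasDecayingOrbit A (∑ i ∈ s, v i) :=
  Finset.sum_induction v _ (fun _ _ => HasDecayingOrbit.add) (HasDecayingOrbit.zero A) h

/-- The coefficients of the exponential of a Jordan block with eigenvalue `c`. -/
noncomputable def jordanCoeff (c : ℂ) (k : ℕ) (t : ℝ) : ℂ :=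
  Complex.exp (-Complex.I * c * t) * ((-Complex.I * t) ^ k / (k.factorial : ℂ))

theorem hasDerivAt_jordanCoeff_zero (c : ℂ) (t : ℝ) :
    HasDerivAt (jordanCoeff c 0) (-Complex.I * (c * jordanCoeff c 0 t)) t := by
  have h1 : HasDerivAt (fun t : ℝ => -Complex.I * c * (t : ℂ)) (-Complex.I * c * 1) t :=
    (Complex.ofRealCLM.hasDerivAt (x := t)).const_mul _
  have h := h1.cexp
  have he : jordanCoeff c 0 = fun t : ℝ => Complex.exp (-Complex.I * c * t) := by
    funext t; simp [jordanCoeff]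
  rw [he]
  convert h using 1
  ring

theorem hasDerivAt_jordanCoeff_succ (c : ℂ) (k : ℕ) (t : ℝ) :
    HasDerivAt (jordanCoeff c (k + 1))
      (-Complex.I * (c * jordanCoeff c (k + 1) t + jordanCoeff c k t)) t := by
  have h1 : HasDerivAt (fun t : ℝ => -Complex.I * c * (t : ℂ)) (-Complex.I * c * 1) t :=
    (Complex.ofRealCLM.hasDerivAt (x := t)).const_mul _
  have h2 : HasDerivAt (fun t : ℝ => -Complex.I * (t : ℂ)) (-Complex.I * 1) t :=
    (Complex.ofRealCLM.hasDerivAt (x := t)).const_mul _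
  have h := h1.cexp.mul ((h2.pow (k + 1)).div_const ((k + 1).factorial : ℂ))
  refine HasDerivAt.congr_deriv (f := jordanCoeff c (k + 1)) h ?_
  have hk : (k.factorial : ℂ) ≠ 0 := by exact_mod_cast k.factorial_ne_zero
  have hk1 : (k : ℂ) + 1 ≠ 0 := by exact_mod_cast k.succ_ne_zero
  simp only [jordanCoeff, Nat.factorial_succ, Nat.cast_mul, Nat.cast_add, Nat.cast_one,
    Nat.add_sub_cancel, Pi.pow_apply]
  field_simp
  ring

theorem tendsto_jordanCoeff {c : ℂ} (hc : c.im < 0) (k : ℕ) :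
    Tendsto (jordanCoeff c k) atTop (𝓝 0) := by
  rw [tendsto_zero_iff_norm_tendsto_zero]
  have h := (tendsto_rpow_mul_exp_neg_mul_atTop_nhds_zero k (-c.im) (by linarith)).div_const
    (k.factorial : ℝ)
  rw [zero_div] at h
  refine h.congr' ?_
  filter_upwards [eventually_ge_atTop 0] with t ht
  rw [jordanCoeff, norm_mul, Complex.norm_exp, norm_div, norm_pow, norm_mul, norm_neg,
    Complex.norm_I, one_mul, Complex.norm_real, Real.norm_of_nonneg ht, Complex.norm_natCast,
    Real.rpow_natCast]
  have : (-Complex.I * c * t).re = - -c.im * t := by simp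
  rw [this]
  ring

/-- On generalised eigenvectors for σ the operator A is invertible, so the orbit is a finite
exponential series: polynomials in t times a factor of modulus exp(t Im σ⁻¹). -/
theorem HasDecayingOrbit.of_pow_eq_zero {A : K →L[ℂ] K} {σ : ℂ} (hσ : σ ≠ 0)
    (him : (σ⁻¹).im < 0) {n : ℕ} {v : K} (hv : ((A - algebraMap ℂ _ σ) ^ n) v = 0) :
    HasDecayingOrbit A v := by
  set x : K →L[ℂ] K := -(σ⁻¹ • (A - algebraMap ℂ _ σ)) with hx
  -- Raising the exponent gives the geometric sum g its term 1 even when n = 0, so that g - 1 is a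
  -- multiple of x.
  have hv : ((A - algebraMap ℂ _ σ) ^ (n + 1)) v = 0 := by
    rw [pow_succ', mul_apply_eq_comp, hv, map_zero]
  have hxn : (x ^ (n + 1)) v = 0 := by
    rw [hx, neg_pow, smul_pow, mul_smul_comm, smul_apply, mul_apply_eq_comp, hv, map_zero,
      smul_zero]
  have hA : A = σ • (1 - x) := by
    rw [hx, sub_neg_eq_add, smul_add, smul_inv_smul₀ hσ, ← Algebra.algebraMap_eq_smul_one]; abel
  set g := ∑ k ∈ Finset.range (n + 1), x ^ k with hg
  have cxg : Commute x g := Commute.sum_right _ _ _ fun k _ => (Commute.refl x).pow_right k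
  have hAg : A * (σ⁻¹ • g) = 1 - x ^ (n + 1) := by
    rw [hA, smul_mul_smul_comm, mul_inv_cancel₀ hσ, one_smul, hg, mul_neg_geom_sum]
  -- Where x ^ (n + 1) vanishes, σ⁻¹ g inverts A = σ (1 - x); Y is the nilpotent part of this
  -- inverse.
  set Y : K →L[ℂ] K := σ⁻¹ • (g - 1) with hY
  have hYx : ∃ h, Y = x * h ∧ Commute x h := by
    refine ⟨σ⁻¹ • ∑ k ∈ Finset.range n, x ^ k, ?_, Commute.smul_right
      (Commute.sum_right _ _ _ fun k _ => (Commute.refl x).pow_right k) _⟩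
    rw [hY, hg, Finset.sum_range_succ', pow_zero, add_sub_cancel_right, mul_smul_comm,
      Finset.mul_sum]
    simp_rw [pow_succ']
  have hYn : (Y ^ (n + 1)) v = 0 := by
    obtain ⟨h, hYh, hc⟩ := hYx
    rw [hYh, hc.mul_pow, (hc.pow_pow _ _).eq, mul_apply_eq_comp, hxn, map_zero]
  have cxY : Commute x Y := (cxg.sub_right (Commute.one_right x)).smul_right _
  have hYw : ∀ y, σ⁻¹ • y + Y y = (σ⁻¹ • g) y := by
    intro y; simp [hY, smul_sub]
  have hAw : ∀ k, A (σ⁻¹ • (Y ^ k) v + Y ((Y ^ k) v)) = (Y ^ k) v := by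
    intro k
    rw [hYw, ← mul_apply_eq_comp, hAg, sub_apply, ← mul_apply_eq_comp (x ^ (n + 1)),
      (cxY.pow_pow (n + 1) k).eq, mul_apply_eq_comp, hxn, map_zero, sub_zero]
    rfl
  set c := σ⁻¹ with hc
  -- These are u = exp(-it(c + Y)) v and w = (c + Y) u.
  refine ⟨fun t => ∑ k ∈ Finset.range (n + 1), jordanCoeff c k t • (Y ^ k) v,
    fun t => ∑ k ∈ Finset.range (n + 1), jordanCoeff c k t • (c • (Y ^ k) v + Y ((Y ^ k) v)),
    ?_, fun t => ?_, fun t => ?_, ?_⟩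
  · dsimp only
    rw [Finset.sum_range_succ', Finset.sum_eq_zero]
    · simp [jordanCoeff]
    · intro k _
      simp [jordanCoeff]
  · have h : HasDerivAt (fun t => ∑ k ∈ Finset.range (n + 1), jordanCoeff c k t • (Y ^ k) v)
        (∑ k ∈ Finset.range n, (-Complex.I * (c * jordanCoeff c (k + 1) t + jordanCoeff c k t)) •
          (Y ^ (k + 1)) v + (-Complex.I * (c * jordanCoeff c 0 t)) • (Y ^ 0) v) t := by
      simp_rw [Finset.sum_range_succ']
      exact (HasDerivAt.fun_sum fun k _ => (hasDerivAt_jordanCoeff_succ c k t).smul_const _).add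
        ((hasDerivAt_jordanCoeff_zero c t).smul_const _)
    convert h using 1
    have hYk : ∀ k, Y ((Y ^ k) v) = (Y ^ (k + 1)) v := fun k => by
      rw [pow_succ', mul_apply_eq_comp]
    simp only [smul_add, Finset.sum_add_distrib, hYk, mul_add, add_smul]
    rw [Finset.sum_range_succ' (fun k => jordanCoeff c k t • c • (Y ^ k) v),
      Finset.sum_range_succ (fun k => jordanCoeff c k t • (Y ^ (k + 1)) v), hYn]
    simp only [smul_zero, add_zero, smul_add, Finset.smul_sum, smul_smul]
    rw [add_right_comm]
    congr 1
    · congr 1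
      refine Finset.sum_congr rfl fun k _ => ?_
      congr 1
      ring
    · congr 1
      ring
  · simp only [map_sum, map_smul, hAw]
  · rw [← Finset.sum_const_zero (s := Finset.range (n + 1))]
    refine tendsto_finsetSum _ fun k _ => ?_
    simpa using (tendsto_jordanCoeff him k).smul_const ((Y ^ k) v)

variable [CompleteSpace K]

/-- If `T` is dissipative in the sense that `y Im ⟪φ, T φ⟫ ≥ 0` with equality only for `T φ = 0`,
then the form `y ⟪v, J v⟫` is positive definite on decaying orbits of `T J`. -/
theorem HasDecayingOrbit.form_pos {T J : K →L[ℂ] K} (hJ : IsSelfAdjoint J) {y : ℝ}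
    (hT : ∀ φ, 0 ≤ y * (inner ℂ φ (T φ)).im)
    (hT0 : ∀ φ, (inner ℂ φ (T φ)).im = 0 → T φ = 0) (hy : y ≠ 0) {v : K}
    (hv : HasDecayingOrbit (T ∘L J) v) :
    0 ≤ y * (inner ℂ v (J v)).re ∧ (y * (inner ℂ v (J v)).re = 0 → v = 0) := by
  obtain ⟨u, w, h0, hd, hA, hl⟩ := hv
  have hsym : ∀ a b, inner ℂ (J a) b = inner ℂ a (J b) := fun a b => by
    rw [← ContinuousLinearMap.adjoint_inner_right, hJ.adjoint_eq]
  set f : ℝ → ℝ := fun t => y * (inner ℂ (u t) (J (u t))).re with hf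
  have hderiv : ∀ t, HasDerivAt f (-2 * (y * (inner ℂ (J (w t)) (T (J (w t)))).im)) t := by
    intro t
    have hJd : HasDerivAt (fun t => J (u t)) (J (-Complex.I • w t)) t :=
      (J.restrictScalars ℝ).hasFDerivAt.comp_hasDerivAt t (hd t)
    have h1 := (hd t).inner ℂ hJd
    have h2 := (Complex.reCLM.hasFDerivAt.comp_hasDerivAt t h1).const_mul y
    refine HasDerivAt.congr_deriv (f := f) h2 ?_
    have hTJ : T (J (w t)) = u t := hA t
    -- The two terms of the derivative are conjugate since J is symmetric, whence the factor 2.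
    have h3 : inner ℂ (u t) (J (-Complex.I • w t)) =
        starRingEnd ℂ (inner ℂ (-Complex.I • w t) (J (u t))) := by
      rw [inner_conj_symm, hsym]
    rw [h3, hTJ, hsym, inner_smul_left]
    generalize inner ℂ (w t) (J (u t)) = q
    simp
    ring
  have hanti : Antitone f := antitone_of_deriv_nonpos (fun t => (hderiv t).differentiableAt)
    fun t => by rw [(hderiv t).deriv]; have := hT (J (w t)); linarith
  have hlim : Tendsto f atTop (𝓝 0) := by
    have : Tendsto f atTop (𝓝 (y * (inner ℂ (0 : K) (J 0)).re)) :=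
      (Complex.continuous_re.tendsto _).comp (hl.inner ((J.continuous.tendsto 0).comp hl))
        |>.const_mul y
    simpa using this
  have hnn : ∀ t, 0 ≤ f t := fun t => hanti.le_of_tendsto hlim t
  have hf0 : f 0 = y * (inner ℂ v (J v)).re := by rw [hf]; simp only [h0]
  refine ⟨hf0 ▸ hnn 0, fun hz => ?_⟩
  rw [← hf0] at hz
  have hzero : ∀ t ∈ Set.Ici (0 : ℝ), f t = 0 := fun t ht =>
    le_antisymm (hz ▸ hanti ht) (hnn t)
  -- f is known to vanish only on [0, ∞), so the derivatives at 0 are compared one-sidedly.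
  have hd0 : -2 * (y * (inner ℂ (J (w 0)) (T (J (w 0)))).im) = 0 :=
    (uniqueDiffOn_Ici (0 : ℝ) 0 Set.self_mem_Ici).eq_deriv _ (hderiv 0).hasDerivWithinAt
      ((hasDerivWithinAt_const 0 (Set.Ici (0 : ℝ)) (0 : ℝ)).congr hzero (hzero 0 Set.self_mem_Ici))
  have := hT0 (J (w 0)) (by
    rcases mul_eq_zero.mp hd0 with h | h
    · norm_num at h
    · exact (mul_eq_zero.mp h).resolve_left hy)
  rw [← h0, ← hA 0]
  exact this

end Orbits

/-! ### Resolvents of unbounded self-adjoint operators -/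

section SelfAdjoint

variable {E : Type*} [NormedAddCommGroup E] [InnerProductSpace ℂ E] [CompleteSpace E]

theorem inner_apply_of_isSelfAdjoint {H : E →ₗ.[ℂ] E} (hH : IsSelfAdjoint H) (x y : H.domain) :
    inner ℂ (H x) (y : E) = inner ℂ (x : E) (H y) := by
  have h := LinearPMap.adjoint_isFormalAdjoint hH.dense_domain
  rw [LinearPMap.isSelfAdjoint_def.mp hH] at h
  exact h x y

omit [CompleteSpace E] in
theorem shift_apply (H : E →ₗ.[ℂ] E) (z : ℂ) (x : H.domain) :
    shift H z x = H x - z • (x : E) := by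
  change -(z • (x : E)) + H x = _
  abel

/-- ⟨Hx, x⟩ is real; the sign is plus because the inner product is conjugate-linear in its first
argument. -/
theorem im_inner_shift {H : E →ₗ.[ℂ] E} (hH : IsSelfAdjoint H) (z : ℂ) (x : H.domain) :
    (inner ℂ (H x - z • (x : E)) (x : E)).im = z.im * ‖(x : E)‖ ^ 2 := by
  have him : (inner ℂ (H x) (x : E)).im = 0 := by
    have h : starRingEnd ℂ (inner ℂ (H x) (x : E)) = inner ℂ (H x) (x : E) := by
      rw [inner_conj_symm, inner_apply_of_isSelfAdjoint hH]
    exact Complex.conj_eq_iff_im.mp h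
  rw [inner_sub_left, inner_smul_left, Complex.sub_im, him, inner_self_eq_norm_sq_to_K]
  simp [← Complex.ofReal_pow]

theorem norm_le_norm_shift {H : E →ₗ.[ℂ] E} (hH : IsSelfAdjoint H) (z : ℂ) (x : H.domain) :
    |z.im| * ‖(x : E)‖ ≤ ‖H x - z • (x : E)‖ := by
  rcases eq_or_ne (x : E) 0 with h0 | h0
  · rw [h0, norm_zero, mul_zero]; exact norm_nonneg _
  have h1 := (Complex.abs_im_le_norm _).trans (norm_inner_le_norm (𝕜 := ℂ)
    (H x - z • (x : E)) (x : E))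
  rw [im_inner_shift hH, abs_mul, abs_of_nonneg (sq_nonneg ‖(x : E)‖), sq, ← mul_assoc] at h1
  exact le_of_mul_le_mul_right h1 (norm_pos_iff.mpr h0)

/-- `H - z` is onto for self-adjoint `H` and non-real `z`. -/
theorem exists_shift_eq {H : E →ₗ.[ℂ] E} (hH : IsSelfAdjoint H) {z : ℂ} (hz : z.im ≠ 0) (y : E) :
    ∃ x : H.domain, H x - z • (x : E) = y := by
  let L : H.domain →ₗ[ℂ] E := H.toFun - z • H.domain.subtype
  have hL : ∀ x, L x = H x - z • (x : E) := fun x => rfl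
  have hclosed : IsClosed (LinearMap.range L : Set E) := by
    rw [← isSeqClosed_iff_isClosed]
    intro s y hs hy
    choose x hx using hs
    have hzp : 0 < |z.im| := abs_pos.mpr hz
    have hc : CauchySeq fun n => (x n : E) := by
      have hyc := hy.cauchySeq
      rw [Metric.cauchySeq_iff'] at hyc ⊢
      intro ε hε
      obtain ⟨N, hN⟩ := hyc (|z.im| * ε) (by positivity)
      refine ⟨N, fun n hn => ?_⟩
      have h := norm_le_norm_shift hH z (x n - x N)
      have h2 : H (x n - x N) - z • ((x n - x N : H.domain) : E) = s n - s N := by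
        rw [← hL, map_sub, hx, hx]
      have h3 := hN n hn
      rw [h2] at h
      rw [dist_eq_norm] at h3 ⊢
      exact lt_of_mul_lt_mul_left (h.trans_lt h3) hzp.le
    obtain ⟨x', hx'⟩ := cauchySeq_tendsto_of_complete hc
    have hHx : Tendsto (fun n => H (x n)) atTop (𝓝 (y + z • x')) := by
      have : (fun n => H (x n)) = fun n => s n + z • (x n : E) := by
        funext n; rw [← hx, hL]; abel
      rw [this]
      exact hy.add (hx'.const_smul z)
    have hmem : (x', y + z • x') ∈ H.graph :=
      hH.isClosed.mem_of_tendsto (hx'.prodMk_nhds hHx) (Eventually.of_forall fun n => H.mem_graph _)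
    obtain ⟨a, ha, hb⟩ := H.mem_graph_iff.mp hmem
    refine ⟨a, ?_⟩
    rw [hL, hb, ha]
    simp
  -- A vector y orthogonal to the range lies in dom H* = dom H with Hy = z̄y, which the lower bound
  -- on H - z̄ excludes unless y = 0.
  have hdense : (LinearMap.range L)ᗮ = ⊥ := by
    rw [Submodule.eq_bot_iff]
    intro y hy
    have hy' : ∀ x : H.domain, inner ℂ (starRingEnd ℂ z • y) (x : E) = inner ℂ y (H x) := by
      intro x
      have h := Submodule.inner_left_of_mem_orthogonal (LinearMap.mem_range_self L x) hy
      rw [hL, inner_sub_right, sub_eq_zero, inner_smul_right] at h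
      rw [h, inner_smul_left, Complex.conj_conj]
    have hyd : y ∈ H.adjoint.domain := LinearPMap.mem_adjoint_domain_of_exists y ⟨_, hy'⟩
    have hye := LinearPMap.adjoint_apply_eq hH.dense_domain ⟨y, hyd⟩ hy'
    have hgr : (y, starRingEnd ℂ z • y) ∈ H.graph := by
      rw [← LinearPMap.isSelfAdjoint_def.mp hH, ← hye]
      exact LinearPMap.mem_graph _ ⟨y, hyd⟩
    obtain ⟨a, ha, hb⟩ := H.mem_graph_iff.mp hgr
    have h := norm_le_norm_shift hH (starRingEnd ℂ z) a
    rw [hb, ha] at h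
    simp only [sub_self, norm_zero, Complex.conj_im, abs_neg] at h
    have hzp : 0 < |z.im| := abs_pos.mpr hz
    exact norm_le_zero_iff.mp (nonpos_of_mul_nonpos_right h hzp)
  have : CompleteSpace (LinearMap.range L) := hclosed.completeSpace_coe
  have htop := (Submodule.orthogonal_eq_bot_iff).mp hdense
  have hy : y ∈ LinearMap.range L := htop ▸ Submodule.mem_top
  exact hy

theorem ker_shift_eq_bot {H : E →ₗ.[ℂ] E} (hH : IsSelfAdjoint H) {z : ℂ} (hz : z.im ≠ 0) :
    LinearMap.ker (shift H z).toFun = ⊥ := by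
  rw [LinearMap.ker_eq_bot']
  intro x hx
  have h := norm_le_norm_shift hH z x
  have h0 : H x - z • (x : E) = 0 := (shift_apply H z x).symm.trans hx
  rw [h0, norm_zero] at h
  exact Subtype.ext (norm_le_zero_iff.mp (nonpos_of_mul_nonpos_right h (abs_pos.mpr hz)))

theorem res_domain_eq_top {H : E →ₗ.[ℂ] E} (hH : IsSelfAdjoint H) {z : ℂ} (hz : z.im ≠ 0) :
    (res H z).domain = ⊤ := by
  rw [res, LinearPMap.inverse_domain, LinearMap.range_eq_top]
  intro y
  obtain ⟨x, hx⟩ := exists_shift_eq hH hz y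
  exact ⟨x, (shift_apply H z x).trans hx⟩

theorem res_apply_eq {H : E →ₗ.[ℂ] E} (hH : IsSelfAdjoint H) {z : ℂ} (hz : z.im ≠ 0)
    (y : (res H z).domain) (x : H.domain) (hxy : H x - z • (x : E) = y) : res H z y = x :=
  LinearPMap.inverse_apply_eq (ker_shift_eq_bot hH hz) (x := x) ((shift_apply H z x).trans hxy)

end SelfAdjoint

/-! ### Density of the domain of the adjoint -/

section Adjoint

variable {𝓗 𝓚 : Type*} [NormedAddCommGroup 𝓗] [InnerProductSpace ℂ 𝓗] [CompleteSpace 𝓗]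
  [NormedAddCommGroup 𝓚] [InnerProductSpace ℂ 𝓚] [CompleteSpace 𝓚]

/-- The adjoint of a closed densely defined operator is densely defined. -/
theorem dense_adjoint_domain {F : 𝓗 →ₗ.[ℂ] 𝓚} (hc : F.IsClosed) :
    Dense (F.adjoint.domain : Set 𝓚) := by
  rw [Submodule.dense_iff_topologicalClosure_eq_top, Submodule.topologicalClosure_eq_top_iff,
    Submodule.eq_bot_iff]
  intro φ hφ
  let e := WithLp.linearEquiv 2 ℂ (𝓗 × 𝓚)
  let G : Submodule ℂ (WithLp 2 (𝓗 × 𝓚)) := F.graph.comap e.toLinearMap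
  have hG : IsClosed (G : Set (WithLp 2 (𝓗 × 𝓚))) :=
    hc.preimage (WithLp.prod_continuous_ofLp 2 𝓗 𝓚)
  have : CompleteSpace G := hG.completeSpace_coe
  -- Elements of Gᗮ have the form (-F*ψ, ψ), and φ is orthogonal to every such ψ.
  have hmem : WithLp.toLp 2 ((0 : 𝓗), φ) ∈ Gᗮᗮ := by
    rw [Submodule.mem_orthogonal]
    intro p hp
    have hadj : p.ofLp.2 ∈ F.adjoint.domain := by
      refine LinearPMap.mem_adjoint_domain_of_exists _ ⟨-p.ofLp.1, fun x => ?_⟩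
      have hx : WithLp.toLp 2 ((x : 𝓗), F x) ∈ G := F.mem_graph x
      have h := Submodule.inner_left_of_mem_orthogonal hx hp
      rw [WithLp.prod_inner_apply] at h
      rw [inner_neg_left, neg_eq_iff_add_eq_zero]
      exact h
    rw [WithLp.prod_inner_apply]
    have h := Submodule.inner_right_of_mem_orthogonal hadj hφ
    simpa using h
  rw [G.orthogonal_orthogonal] at hmem
  exact LinearPMap.graph_fst_eq_zero_snd F (x := 0) (x' := φ) hmem rfl

end Adjoint

/-! ### The sandwiched resolvent: compactness, adjoint, dissipativity -/

section Line

variable {𝓗 𝓚 : Type*} [NormedAddCommGroup 𝓗] [InnerProductSpace ℂ 𝓗] [CompleteSpace 𝓗]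
  [NormedAddCommGroup 𝓚] [InnerProductSpace ℂ 𝓚] [CompleteSpace 𝓚]
  {H₀ : 𝓗 →ₗ.[ℂ] 𝓗} {F : 𝓗 →ₗ.[ℂ] 𝓚} {J : 𝓚 →L[ℂ] 𝓚}

omit [CompleteSpace 𝓚] in
theorem sandwichedRes_domain_and_apply {H : 𝓗 →ₗ.[ℂ] 𝓗} (hH : IsSelfAdjoint H)
    (hHF : H.domain ≤ F.domain) {z : ℂ} (hz : z.im ≠ 0) (φ : F.adjoint.domain) :
    ∃ (h : (φ : 𝓚) ∈ (sandwichedRes F H z).domain) (x : 𝓗) (hx : x ∈ H.domain),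
      H ⟨x, hx⟩ - z • x = F.adjoint φ ∧ sandwichedRes F H z ⟨φ, h⟩ = F ⟨x, hHF hx⟩ := by
  obtain ⟨x, hx⟩ := exists_shift_eq hH hz (F.adjoint φ)
  have h1 : F.adjoint φ ∈ (res H z).domain := by rw [res_domain_eq_top hH hz]; trivial
  have h2 : (φ : 𝓚) ∈ (pcomp (res H z) F.adjoint).domain :=
    (mem_pcomp_domain _ _ _).mpr ⟨φ.2, h1⟩
  have h3 : pcomp (res H z) F.adjoint ⟨φ, h2⟩ = x :=
    (pcomp_apply _ _ _ φ.2 h1 h2).trans (res_apply_eq hH hz ⟨_, h1⟩ x hx)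
  have h4 : pcomp (res H z) F.adjoint ⟨φ, h2⟩ ∈ F.domain := by rw [h3]; exact hHF x.2
  have h5 : (φ : 𝓚) ∈ (sandwichedRes F H z).domain := (mem_pcomp_domain _ _ _).mpr ⟨h2, h4⟩
  refine ⟨h5, x, x.2, hx, (pcomp_apply _ _ _ h2 h4 h5).trans ?_⟩
  congr 1
  exact Subtype.ext h3

namespace StandingAssumptions

variable (hyp : StandingAssumptions H₀ F J)
include hyp

theorem line_domain (s : ℝ) : (line H₀ F J s).domain = H₀.domain :=
  inf_eq_left.mpr hyp.domain_le_V

theorem line_domain_le (s : ℝ) : (line H₀ F J s).domain ≤ F.domain :=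
  (hyp.line_domain s).trans_le hyp.domain_le_F

theorem dense_adjoint : Dense (F.adjoint.domain : Set 𝓚) :=
  dense_adjoint_domain hyp.isRigging.isClosed

theorem exists_T_apply {z : ℂ} (hz : z.im ≠ 0) (s : ℝ) (φ : F.adjoint.domain) :
    ∃ x : (line H₀ F J s).domain, line H₀ F J s x - z • (x : 𝓗) = F.adjoint φ ∧
      T H₀ F J z s φ = F ⟨x, hyp.line_domain_le s x.2⟩ := by
  obtain ⟨h, x, hx, hxφ, hF⟩ := sandwichedRes_domain_and_apply (hyp.selfAdjoint_line s)
    (hyp.line_domain_le s) hz φ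
  refine ⟨⟨x, hx⟩, hxφ, ?_⟩
  obtain ⟨T', -, hT'⟩ := hyp.compact s z hz
  have hex : ∃ T : 𝓚 →L[ℂ] 𝓚, ∀ x : (sandwichedRes F (line H₀ F J s) z).domain,
      T x = sandwichedRes F (line H₀ F J s) z x := ⟨T', hT'⟩
  rw [T, boundedExtension, dif_pos hex, ← hF]
  exact hex.choose_spec ⟨φ, h⟩

/-- `T` is defined by a choice of bounded extension; density of dom F* forces it to be the compact
one. -/
theorem isCompactOperator_T {z : ℂ} (hz : z.im ≠ 0) (s : ℝ) :
    IsCompactOperator (T H₀ F J z s) := by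
  obtain ⟨T', hc, hT'⟩ := hyp.compact s z hz
  have hex : ∃ T : 𝓚 →L[ℂ] 𝓚, ∀ x : (sandwichedRes F (line H₀ F J s) z).domain,
      T x = sandwichedRes F (line H₀ F J s) z x := ⟨T', hT'⟩
  suffices T H₀ F J z s = T' by rwa [this]
  refine DFunLike.coe_injective ?_
  refine Continuous.ext_on hyp.dense_adjoint (T H₀ F J z s).continuous T'.continuous fun φ hφ => ?_
  obtain ⟨h, -⟩ := sandwichedRes_domain_and_apply (hyp.selfAdjoint_line s)
    (hyp.line_domain_le s) hz ⟨φ, hφ⟩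
  rw [T, boundedExtension, dif_pos hex]
  exact (hex.choose_spec ⟨φ, h⟩).trans (hT' ⟨φ, h⟩).symm

theorem inner_F_apply (x : F.domain) (ψ : F.adjoint.domain) :
    inner ℂ (ψ : 𝓚) (F x) = inner ℂ (F.adjoint ψ) (x : 𝓗) :=
  (LinearPMap.adjoint_isFormalAdjoint hyp.isRigging.dense_domain ψ x).symm

theorem adjoint_T {z : ℂ} (hz : z.im ≠ 0) (s : ℝ) :
    ContinuousLinearMap.adjoint (T H₀ F J z s) = T H₀ F J (starRingEnd ℂ z) s := by
  symm
  rw [ContinuousLinearMap.eq_adjoint_iff]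
  set T₁ := T H₀ F J z s with hT₁
  set T₂ := T H₀ F J (starRingEnd ℂ z) s with hT₂
  have hz' : (starRingEnd ℂ z).im ≠ 0 := by simpa using hz
  have key : ∀ φ ψ : F.adjoint.domain, inner ℂ (T₂ φ) (ψ : 𝓚) = inner ℂ (φ : 𝓚) (T₁ ψ) := by
    intro φ ψ
    obtain ⟨x, hx, hTx⟩ := hyp.exists_T_apply hz' s φ
    obtain ⟨y, hy, hTy⟩ := hyp.exists_T_apply hz s ψ
    rw [hT₁, hT₂, hTx, hTy, ← inner_conj_symm, hyp.inner_F_apply, hyp.inner_F_apply,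
      inner_conj_symm, ← hx, ← hy, inner_sub_left, inner_sub_right, inner_smul_left,
      inner_smul_right, Complex.conj_conj, inner_apply_of_isSelfAdjoint (hyp.selfAdjoint_line s)]
  intro φ ψ
  refine hyp.dense_adjoint.induction (P := fun φ => inner ℂ (T₂ φ) ψ = inner ℂ φ (T₁ ψ))
    (fun φ hφ => ?_) (isClosed_eq (by fun_prop) (by fun_prop)) φ
  exact hyp.dense_adjoint.induction (P := fun ψ => inner ℂ (T₂ φ) ψ = inner ℂ φ (T₁ ψ))
    (fun ψ hψ => key ⟨φ, hφ⟩ ⟨ψ, hψ⟩) (isClosed_eq (by fun_prop) (by fun_prop)) ψ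

/-- A quantitative form of the strict positivity of `Im z · Im T_z(H_s)`. -/
theorem sq_norm_inner_T_le {z : ℂ} (hz : z.im ≠ 0) (s : ℝ) (ψ : F.adjoint.domain) (φ : 𝓚) :
    z.im ^ 2 * ‖inner ℂ (ψ : 𝓚) (T H₀ F J z s φ)‖ ^ 2 ≤
      ‖F.adjoint ψ‖ ^ 2 * (z.im * (inner ℂ φ (T H₀ F J z s φ)).im) := by
  -- The vector x = R_z F*φ exists only for φ in dom F*. Eliminating ‖x‖ leaves an inequality
  -- continuous in φ, which passes to the closure.
  refine hyp.dense_adjoint.induction (P := fun φ =>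
    z.im ^ 2 * ‖inner ℂ (ψ : 𝓚) (T H₀ F J z s φ)‖ ^ 2 ≤
      ‖F.adjoint ψ‖ ^ 2 * (z.im * (inner ℂ φ (T H₀ F J z s φ)).im)) (fun φ hφ => ?_)
    (isClosed_le (by fun_prop) (by fun_prop)) φ
  obtain ⟨x, hx, hTx⟩ := hyp.exists_T_apply hz s ⟨φ, hφ⟩
  have h1 := im_inner_shift (hyp.selfAdjoint_line s) z x
  rw [hx, ← hyp.inner_F_apply ⟨x, hyp.line_domain_le s x.2⟩ ⟨φ, hφ⟩, ← hTx] at h1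
  have h2 : ‖inner ℂ (ψ : 𝓚) (T H₀ F J z s φ)‖ ≤ ‖F.adjoint ψ‖ * ‖(x : 𝓗)‖ := by
    rw [hTx, hyp.inner_F_apply ⟨x, hyp.line_domain_le s x.2⟩ ψ]
    exact norm_inner_le_norm _ _
  rw [h1]
  calc z.im ^ 2 * ‖inner ℂ (ψ : 𝓚) (T H₀ F J z s φ)‖ ^ 2
      ≤ z.im ^ 2 * (‖F.adjoint ψ‖ * ‖(x : 𝓗)‖) ^ 2 := by gcongr
    _ = _ := by ring

theorem im_inner_T_nonneg {z : ℂ} (hz : z.im ≠ 0) (s : ℝ) (φ : 𝓚) :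
    0 ≤ z.im * (inner ℂ φ (T H₀ F J z s φ)).im := by
  refine hyp.dense_adjoint.induction (P := fun φ =>
    0 ≤ z.im * (inner ℂ φ (T H₀ F J z s φ)).im) (fun φ hφ => ?_)
    (isClosed_le (by fun_prop) (by fun_prop)) φ
  obtain ⟨x, hx, hTx⟩ := hyp.exists_T_apply hz s ⟨φ, hφ⟩
  have h1 := im_inner_shift (hyp.selfAdjoint_line s) z x
  rw [hx, ← hyp.inner_F_apply ⟨x, hyp.line_domain_le s x.2⟩ ⟨φ, hφ⟩, ← hTx] at h1
  rw [h1, ← mul_assoc]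
  exact mul_nonneg (mul_self_nonneg _) (sq_nonneg _)

/-- The preceding estimate makes Tφ orthogonal to the dense subspace dom F*. -/
theorem T_apply_eq_zero {z : ℂ} (hz : z.im ≠ 0) (s : ℝ) (φ : 𝓚)
    (h : (inner ℂ φ (T H₀ F J z s φ)).im = 0) : T H₀ F J z s φ = 0 := by
  refine hyp.dense_adjoint.eq_zero_of_inner_right ℂ fun ψ hψ => ?_
  have h1 := hyp.sq_norm_inner_T_le hz s ⟨ψ, hψ⟩ φ
  rw [h, mul_zero, mul_zero, ← mul_pow] at h1
  have h2 := pow_eq_zero_iff (two_ne_zero) |>.mp (le_antisymm h1 (sq_nonneg _))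
  exact norm_eq_zero.mp ((mul_eq_zero.mp h2).resolve_left hz)

end StandingAssumptions

end Line

/-! ### Q as the adjoint of P, and decay on the range of P -/

section Main

theorem rank_eq_of_ker_eq {K : Type*} [AddCommGroup K] [Module ℂ K] {f g : K →ₗ[ℂ] K}
    (h : LinearMap.ker f = LinearMap.ker g) : LinearMap.rank f = LinearMap.rank g :=
  (f.quotKerEquivRange.symm.trans ((Submodule.quotEquivOfEq _ _ h).trans
    g.quotKerEquivRange)).rank_eq

section Riesz

variable {K : Type*} [NormedAddCommGroup K] [InnerProductSpace ℂ K] [CompleteSpace K]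

/-- Riesz idempotents of `A` and `A*`, when `A*` is compact. -/
theorem rieszIdempotent_adjoint_and_nilpotent {A : K →L[ℂ] K}
    (hA : IsCompactOperator (ContinuousLinearMap.adjoint A)) {σ : ℂ} (hσ : σ ≠ 0) :
    rieszIdempotent (ContinuousLinearMap.adjoint A) (starRingEnd ℂ σ) =
        ContinuousLinearMap.adjoint (rieszIdempotent A σ) ∧
      ∃ n : ℕ, (A - algebraMap ℂ _ σ) ^ n * rieszIdempotent A σ = 0 := by
  obtain ⟨n, S, E, hDS, hSD, hES, hSE, hn⟩ := exists_splitting hA hσ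
  have hE := rieszIdempotent_eq_of_splitting hDS hSD hES hn
  have cDE : Commute (A - algebraMap ℂ _ σ) E := by
    have h : E = 1 - (A - algebraMap ℂ _ σ) * S := by rw [hDS]; abel
    have hc : Commute (A - algebraMap ℂ _ σ) S := by rw [Commute, SemiconjBy, hDS, hSD]
    rw [h]
    exact (Commute.one_right _).sub_right ((Commute.refl _).mul_right hc)
  refine ⟨?_, n, by rw [hE, hn]⟩
  rw [hE, ← ContinuousLinearMap.star_eq_adjoint E]
  have hs : star (A - algebraMap ℂ _ σ) =
      ContinuousLinearMap.adjoint A - algebraMap ℂ _ (starRingEnd ℂ σ) := by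
    rw [ContinuousLinearMap.star_eq_adjoint, adjoint_sub_algebraMap]
  refine rieszIdempotent_eq_of_splitting (S := star S) (n := n) ?_ ?_ ?_ ?_
  · rw [← hs, ← star_mul, hSD, star_sub, star_one]
  · rw [← hs, ← star_mul, hDS, star_sub, star_one]
  · rw [← star_mul, hSE, star_zero]
  · rw [← hs, ← star_pow, ← star_mul, ← (cDE.pow_left n).eq, hn, star_zero]

end Riesz

variable {𝓗 𝓚 : Type*} [NormedAddCommGroup 𝓗] [InnerProductSpace ℂ 𝓗] [CompleteSpace 𝓗]
  [NormedAddCommGroup 𝓚] [InnerProductSpace ℂ 𝓚] [CompleteSpace 𝓚]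
  {H₀ : 𝓗 →ₗ.[ℂ] 𝓗} {F : 𝓗 →ₗ.[ℂ] 𝓚} {J : 𝓚 →L[ℂ] 𝓚}

namespace StandingAssumptions

variable (hyp : StandingAssumptions H₀ F J)
include hyp

theorem adjoint_A {z : ℂ} (hz : z.im ≠ 0) (s : ℝ) :
    ContinuousLinearMap.adjoint (A H₀ F J z s) = B H₀ F J (starRingEnd ℂ z) s := by
  rw [A, B, ContinuousLinearMap.adjoint_comp, hyp.adjoint_T hz, hyp.selfAdjoint_J.adjoint_eq]

theorem isCompactOperator_adjoint_A {z : ℂ} (hz : z.im ≠ 0) (s : ℝ) :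
    IsCompactOperator (ContinuousLinearMap.adjoint (A H₀ F J z s)) := by
  rw [hyp.adjoint_A hz, B]
  exact (hyp.isCompactOperator_T (by simpa using hz) s).clm_comp J

theorem Q_conj_eq_adjoint_P {z : ℂ} (hz : z.im ≠ 0) (s : ℝ) {Γ : Finset ℂ}
    (hΓ : ∀ r ∈ Γ, 0 < r.im) :
    Q H₀ F J s (starRingEnd ℂ z) (Γ.image (starRingEnd ℂ)) =
      ContinuousLinearMap.adjoint (P H₀ F J s z Γ) := by
  rw [Q, P, map_sum, Finset.sum_image fun _ _ _ _ h => (starRingEnd ℂ).injective h]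
  refine Finset.sum_congr rfl fun r hr => ?_
  -- Im r > 0 gives s ≠ r, so this is a genuine inverse and a non-zero point, as Riesz theory
  -- requires.
  have h0 : ((s : ℂ) - r)⁻¹ ≠ 0 := by
    refine inv_ne_zero fun h => (hΓ r hr).ne' ?_
    simpa using congrArg Complex.im h
  rw [← (rieszIdempotent_adjoint_and_nilpotent (hyp.isCompactOperator_adjoint_A hz s) h0).1,
    hyp.adjoint_A hz]
  simp

/-- Each summand of P x is a generalised eigenvector with Im(s - r) < 0, and decaying orbits add; no
relation between the idempotents at different r is needed. -/
theorem hasDecayingOrbit_P {z : ℂ} (hz : z.im ≠ 0) (s : ℝ) {Γ : Finset ℂ}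
    (hΓ : ∀ r ∈ Γ, 0 < r.im) (x : 𝓚) : HasDecayingOrbit (A H₀ F J z s) (P H₀ F J s z Γ x) := by
  rw [P, sum_apply]
  refine HasDecayingOrbit.sum Γ fun r hr => ?_
  have h0 : ((s : ℂ) - r)⁻¹ ≠ 0 := by
    refine inv_ne_zero fun h => (hΓ r hr).ne' ?_
    simpa using congrArg Complex.im h
  obtain ⟨-, n, hn⟩ :=
    rieszIdempotent_adjoint_and_nilpotent (hyp.isCompactOperator_adjoint_A hz s) h0
  refine HasDecayingOrbit.of_pow_eq_zero h0 ?_ (n := n) ?_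
  · simpa using hΓ r hr
  · rw [← mul_apply_eq_comp, hn, zero_apply]

end StandingAssumptions

end Main

end Resonance

theorem theoremT {𝓗 𝓚 : Type*}
    [NormedAddCommGroup 𝓗] [InnerProductSpace ℂ 𝓗] [CompleteSpace 𝓗]
    [NormedAddCommGroup 𝓚] [InnerProductSpace ℂ 𝓚] [CompleteSpace 𝓚]
    (H₀ : 𝓗 →ₗ.[ℂ] 𝓗) (F : 𝓗 →ₗ.[ℂ] 𝓚) (J : 𝓚 →L[ℂ] 𝓚)
    (hyp : Resonance.StandingAssumptions H₀ F J)
    (z : ℂ) (hz : z.im ≠ 0)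
    (Γ : Finset ℂ) (hΓ : ∀ r ∈ Γ, Resonance.IsUpPoint H₀ F J z r) (s : ℝ) :
    ((z.im : ℂ) • (Resonance.Q H₀ F J s (starRingEnd ℂ z) (Γ.image (starRingEnd ℂ)) ∘L J ∘L
        Resonance.P H₀ F J s z Γ)).IsPositive ∧
      LinearMap.rank (((z.im : ℂ) •
        (Resonance.Q H₀ F J s (starRingEnd ℂ z) (Γ.image (starRingEnd ℂ)) ∘L J ∘L
          Resonance.P H₀ F J s z Γ) : 𝓚 →L[ℂ] 𝓚) : 𝓚 →ₗ[ℂ] 𝓚) =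
        LinearMap.rank (Resonance.P H₀ F J s z Γ : 𝓚 →ₗ[ℂ] 𝓚) := by
  have him : ∀ r ∈ Γ, 0 < r.im := fun r hr => (hΓ r hr).2
  rw [hyp.Q_conj_eq_adjoint_P hz s him]
  have horb := hyp.hasDecayingOrbit_P hz s him
  set P := Resonance.P H₀ F J s z Γ
  set M := (z.im : ℂ) • (ContinuousLinearMap.adjoint P ∘L J ∘L P) with hM
  have hform := fun x => (horb x).form_pos hyp.selfAdjoint_J (hyp.im_inner_T_nonneg hz s)
    (hyp.T_apply_eq_zero hz s) hz
  have hinner : ∀ x, (inner ℂ x (M x)).re = z.im * (inner ℂ (P x) (J (P x))).re := by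
    intro x
    rw [hM, smul_apply, inner_smul_right, ContinuousLinearMap.comp_apply,
      ContinuousLinearMap.adjoint_inner_right, Complex.re_ofReal_mul]
    rfl
  have hsa : IsSelfAdjoint M := by
    refine IsSelfAdjoint.smul (Complex.conj_ofReal _) ?_
    exact hyp.selfAdjoint_J.adjoint_conj P
  -- The rank depends only on the kernel, and M x = 0 makes the form vanish at P x, so P x = 0 by
  -- definiteness.
  refine ⟨⟨hsa.isSymmetric, fun x => ?_⟩, Resonance.rank_eq_of_ker_eq ?_⟩
  · rw [ContinuousLinearMap.reApplyInnerSelf_apply, inner_re_symm]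
    exact (hform x).1.trans_eq (hinner x).symm
  · ext x
    constructor
    · intro hx
      have hx : M x = 0 := hx
      refine (hform x).2 ?_
      rw [← hinner, hx, inner_zero_right, Complex.zero_re]
    · intro hx
      have hx : P x = 0 := hx
      change M x = 0
      simp [hM, hx]
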